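/- Let $M$ be a monoid with a monoid presentation $\langle X\mid R\rangle$ via $\varphi$; that is, $R\subseteq X^*\times X^*$, and $\varphi:X^*\to M$ is a surjective monoid morphism whose kernel is the congruence generated by $R$. Let $M_0=M\cup\{0\}$ be obtained by adjoining a new zero $0$ to $M$ (even if $M$ already has one). Let $M\wr\mathcal I$ be the category with object set $\mathbb N=\{0,1,2,\ldots\}$ whose morphisms $m\to n$ are the pairs $(\mathbf a,\alpha)$, where $\alpha$ is an injective partial map $\{1,\ldots,m\}\to\{1,\ldots,n\}$ and $\mathbf a=(a_1,\ldots,a_m)\in M_0^m$ satisfies $a_i\neq0\iff i\in\operatorname{dom}(\alpha)$. Composition (written left to right) is $(\mathbf a,\alpha)\circ(\mathbf b,\beta)=(\mathbf a\cdot{}^{\alpha}\mathbf b,\alpha\beta)$, where $({}^{\alpha}\mathbf b)_i=b_{i\alpha}$ if $i\in\operatorname{dom}(\alpha)$ and $({}^{\alpha}\mathbf b)_i=0$ otherwise. Let $\Gamma$ be the digraph with vertex set $\mathbb N$ and the following edges, for all $n\in\mathbb N$: loops $s_{i;n}$ ($1\le i<n$), $e_{i;n}$ ($1\le i\le n$)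 and $x^{(i;n)}$ ($x\in X$, $1\le i\le n$) at $n$, and edges $\lambda_n:n\to n+1$ and $\rho_n:n+1\to n$. Let $\Gamma^*$ be the free category on $\Gamma$ (the category of paths), with empty path $\iota_n$ at $n$, and for a word $u=x_1\cdots x_k\in X^*$ put $u^{(i;n)}=x_1^{(i;n)}\cdots x_k^{(i;n)}$ (and $u^{(i;n)}=\iota_n$ if $u$ is empty). Let $\phi:\Gamma^*\to M\wr\mathcal I$ be the functor that is the identity on objects and for which * $s_{i;n}\mapsto$ the transposition $(i,i+1)$ of $\{1,\ldots,n\}$, with all labels $1$; * $e_{i;n}\mapsto$ the identity map on $\{1,\ldots,n\}\setminus\{i\}$, with label $0$ at $i$ and all other labels $1$; * $x^{(i;n)}\mapsto$ the identity map on $\{1,\ldots,n\}$, with label $\varphi(x)$ at $i$ and all other labels $1$; * $\lambda_n\mapsto$ the inclusion $\{1,\ldots,n\}\to\{1,\ldots,n+1\}$, with all labels $1$; * $\rho_n\mapsto$ the partial map $\{1,\ldots,n+1\}\to\{1,\ldots,n\}$ that fixes $1,\ldots,n$ and is undefined at $n+1$, with label $0$ at $n+1$ and all other labels $1$. Let $\Omega$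 be the following set of relations, where $n$, $i$, $j$ and $x,y\in X$ range over all values for which all the generators that occur are defined, subject to the stated constraints: * (MI1) $s_{i;n}^2=\iota_n$, $\ e_{i;n}^2=e_{i;n}$, $\ e_{i;n}e_{j;n}=e_{j;n}e_{i;n}$, $\ s_{i;n}e_{j;n}=e_{j;n}s_{i;n}$ if $j\ne i,i+1$; * (MI2) $s_{i;n}e_{i;n}=e_{i+1;n}s_{i;n}$, $\ e_{i;n}e_{i+1;n}s_{i;n}=e_{i;n}e_{i+1;n}$; * (MI3) $s_{i;n}s_{j;n}=s_{j;n}s_{i;n}$ if $|i-j|>1$, $\ s_{i;n}s_{j;n}s_{i;n}=s_{j;n}s_{i;n}s_{j;n}$ if $|i-j|=1$; * (MI4) $u^{(i;n)}=v^{(i;n)}$ for $(u,v)\in R$, $\ x^{(i;n)}y^{(j;n)}=y^{(j;n)}x^{(i;n)}$ if $i\ne j$; * (MI5) $s_{i;n}x^{(j;n)}=x^{(j;n)}s_{i;n}$ if $j\ne i,i+1$, $\ s_{i;n}x^{(i;n)}=x^{(i+1;n)}s_{i;n}$; * (MI6) $e_{i;n}x^{(j;n)}=x^{(j;n)}e_{i;n}$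 if $i\ne j$, $\ e_{i;n}x^{(i;n)}=e_{i;n}=x^{(i;n)}e_{i;n}$; * (MI7) $\lambda_n\rho_n=\iota_n$, $\ \rho_n\lambda_n=e_{n+1;n+1}$; * (MI8) $s_{i;n}\lambda_n=\lambda_ns_{i;n+1}$, $\ e_{i;n}\lambda_n=\lambda_ne_{i;n+1}$, $\ x^{(i;n)}\lambda_n=\lambda_nx^{(i;n+1)}$; * (MI9) $\rho_ns_{i;n}=s_{i;n+1}\rho_n$, $\ \rho_ne_{i;n}=e_{i;n+1}\rho_n$, $\ \rho_nx^{(i;n)}=x^{(i;n+1)}\rho_n$. **Theorem.** The category $M\wr\mathcal I$ has category presentation $\langle\Gamma\mid\Omega\rangle$ via $\phi$. That is, $\phi$ is the identity on objects, it is surjective on morphisms, and for all paths $p,q\in\Gamma^*$ with the same source and the same target, $p\phi=q\phi$ if and only if $(p,q)$ lies in the smallest congruence on $\Gamma^*$ containing $\Omega$. (A congruence on a category is a family of equivalence relations on its hom-sets that is compatible with composition on the left and on the right.) -/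

import Mathlib

namespace WreathPresentation

open CategoryTheory

universe u v

/-! ### Presentations of monoids and of categories -/

/-- `M` has monoid presentation `⟨X | R⟩` via `φ`: the morphism `φ` from the free monoid on `X` is
surjective and its kernel is the congruence generated by `R`. -/
structure IsMonoidPresentation {X : Type u} {M : Type v} [Monoid M]
    (R : FreeMonoid X → FreeMonoid X → Prop) (φ : FreeMonoid X →* M) : Prop where
  surjective : Function.Surjective φ
  ker_eq : Con.ker φ = conGen R

/-- The smallest congruence on the category `C` containing `Ω`, as the intersection of all the
congruences that contain `Ω`. -/
def congruenceGen {C : Type u} [Category.{v} C] (Ω : HomRel C) : HomRel C :=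
  fun _ _ f g => ∀ σ : HomRel C, Congruence σ →
    (∀ ⦃a b : C⦄ (p q : a ⟶ b), Ω p q → σ p q) → σ f g

/-- `C` has category presentation `⟨Γ | Ω⟩` via `φ`: the functor `φ` from the free category on the
digraph `Γ` is bijective on objects and surjective on morphisms, and its kernel is the congruence
generated by `Ω`. -/
structure IsCategoryPresentation {Γ : Type*} [Quiver Γ] {C : Type*} [Category C]
    (Ω : HomRel (Paths Γ)) (φ : Paths Γ ⥤ C) : Prop where
  obj_bijective : Function.Bijective φ.obj
  map_surjective : ∀ a b : Paths Γ, Function.Surjective (fun p : a ⟶ b => φ.map p)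
  map_eq_iff : ∀ (a b : Paths Γ) (p q : a ⟶ b), φ.map p = φ.map q ↔ congruenceGen Ω p q

/-! ### The wreath product category -/

/-- The tuple `ᵅb`, whose `i`-th entry is `b_{iα}` if `i ∈ dom α`, and is `0` otherwise. -/
def act {M : Type u} {m n : ℕ} (α : Fin m ≃. Fin n) (b : Fin n → WithZero M) :
    Fin m → WithZero M :=
  fun i => (α i).elim 0 b

/-- A morphism `m → n` of `M ≀ I`: a partial bijection `map` from an `m`-element set to an
`n`-element set, with an `m`-tuple `label` over `M ∪ {0}` whose support is the domain of `map`. -/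
@[ext]
structure WreathHom (M : Type u) (m n : ℕ) where
  label : Fin m → WithZero M
  map : Fin m ≃. Fin n
  supp : ∀ i, label i ≠ 0 ↔ (map i).isSome

/-- The identity of `M ≀ I` at `n`. -/
def WreathHom.id (M : Type u) [Monoid M] (n : ℕ) : WreathHom M n n where
  label := 1
  map := PEquiv.refl _
  supp i := by simp

/-- The composition `(a, α) ∘ (b, β) = (a ⬝ ᵅb, αβ)`, where `αβ` means `α` first, then `β`. -/
def WreathHom.comp {M : Type u} [Monoid M] {m n k : ℕ} (f : WreathHom M m n)
    (g : WreathHom M n k) : WreathHom M m k where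
  label := f.label * act f.map g.label
  map := f.map.trans g.map
  supp i := by
    have h := f.supp i
    cases hi : f.map i with
    | none => simp [act, PEquiv.trans, hi]
    | some j =>
      have hj := g.supp j
      rw [hi] at h
      simp only [Pi.mul_apply, act, hi, Option.elim_some, PEquiv.trans, PEquiv.coe_mk_apply,
        Option.bind_some, ← hj]
      simp_all

/-- The objects of `M ≀ I`: the natural numbers. -/
@[nolint unusedArguments]
def WreathCat (_M : Type u) : Type := ℕ

instance (M : Type u) [Monoid M] : Category.{u} (WreathCat M) where
  Hom m n := WreathHom M m n
  id n := WreathHom.id M n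
  comp f g := WreathHom.comp f g
  id_comp {m n} f := by
    apply WreathHom.ext
    · funext i
      simp [WreathHom.comp, WreathHom.id, act]
    · exact PEquiv.refl_trans _
  comp_id {m n} f := by
    apply WreathHom.ext
    · funext i
      have h := WreathHom.supp f i
      cases hi : WreathHom.map f i with
      | none => simp_all [WreathHom.comp, WreathHom.id, act]
      | some j => simp [WreathHom.comp, WreathHom.id, act, hi]
    · exact PEquiv.trans_refl _
  assoc {m n k l} f g h := by
    apply WreathHom.ext
    · funext i
      cases hi : WreathHom.map f i with
      | none => simp [WreathHom.comp, act, hi, PEquiv.trans]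
      | some j => simp [WreathHom.comp, act, hi, PEquiv.trans, mul_assoc]
    · exact PEquiv.trans_assoc _ _ _

/-- A partial bijection `α`, regarded as the morphism with label `1` at the points of `dom α`
and label `0` elsewhere. -/
def WreathHom.ofPEquiv (M : Type u) [Monoid M] {m n : ℕ} (α : Fin m ≃. Fin n) :
    WreathHom M m n where
  label := act α 1
  map := α
  supp i := by cases hi : α i <;> simp [act, hi]

/-- An element `a` of `M`, regarded as the identity partial bijection of an `n`-element set, with
label `a` at `i` and label `1` elsewhere. -/
def WreathHom.single {M : Type u} [Monoid M] {n : ℕ} (i : Fin n) (a : M) : WreathHom M n n where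
  label := Function.update 1 i (a : WithZero M)
  map := PEquiv.refl _
  supp j := by
    by_cases h : j = i
    · subst h; simp
    · simp [h]

/-- The partial bijection `n → n + 1` that fixes the first `n` points. -/
def incl (n : ℕ) : Fin n ≃. Fin (n + 1) where
  toFun i := some i.castSucc
  invFun j := if h : (j : ℕ) < n then some ⟨j, h⟩ else none
  inv i j := by
    simp only [Option.dite_none_right_eq_some, Option.some.injEq, Fin.ext_iff, Fin.val_castSucc]
    constructor
    · rintro ⟨_, h⟩; exact h.symm
    · intro h; exact ⟨h ▸ i.isLt, h.symm⟩

/-! ### Generators -/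

/-- The edges of the digraph on `ℕ`. The `n` points are numbered `0, …, n - 1` instead of
`1, …, n`; there are no other edges than the following. -/
inductive Gen (X : Type u) : ℕ → ℕ → Type u
  | s {n : ℕ} (i : ℕ) (hi : i + 1 < n) : Gen X n n
  | e {n : ℕ} (i : Fin n) : Gen X n n
  | x {n : ℕ} (a : X) (i : Fin n) : Gen X n n
  | lam (n : ℕ) : Gen X n (n + 1)
  | rho (n : ℕ) : Gen X (n + 1) n

/-- The vertices of the digraph of generators: the natural numbers. -/
@[nolint unusedArguments]
def GenGraph (_X : Type u) : Type := ℕ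

instance (X : Type u) : Quiver.{u} (GenGraph X) where
  Hom m n := Gen X m n

/-- The number `n` as an object of the free category. -/
abbrev vert (X : Type u) (n : ℕ) : Paths (GenGraph X) := (n : ℕ)

/-- A generator, as a path of length one. -/
def path {X : Type u} {m n : ℕ} (g : Gen X m n) : vert X m ⟶ vert X n :=
  (Paths.of (GenGraph X)).map g

section
variable {X : Type u} {n : ℕ}

/-- `s i` swaps the points `i` and `i + 1`. -/
abbrev s (i : ℕ) (hi : i + 1 < n) : vert X n ⟶ vert X n := path (Gen.s i hi)
/-- `e i` is undefined at the point `i`. -/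
abbrev e (i : Fin n) : vert X n ⟶ vert X n := path (Gen.e i)
/-- `x a i` puts the letter `a` on the point `i`. -/
abbrev x (a : X) (i : Fin n) : vert X n ⟶ vert X n := path (Gen.x a i)
/-- `lam X n` is the generator `n → n + 1`. -/
abbrev lam (X : Type u) (n : ℕ) : vert X n ⟶ vert X (n + 1) := path (Gen.lam n)
/-- `rho X n` is the generator `n + 1 → n`. -/
abbrev rho (X : Type u) (n : ℕ) : vert X (n + 1) ⟶ vert X n := path (Gen.rho n)

/-- For a word `u = x₁ ⋯ x_k`, the path `u^{(i;n)} = x₁^{(i;n)} ⋯ x_k^{(i;n)}`; the empty word gives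
the empty path at `n`. -/
def wordPath (i : Fin n) : List X → (vert X n ⟶ vert X n)
  | [] => 𝟙 (vert X n)
  | a :: u => x a i ≫ wordPath i u

end

/-! ### Relations -/

/-- The defining relations, for a set `R` of relations between words over `X`. -/
inductive Rel {X : Type u} (R : FreeMonoid X → FreeMonoid X → Prop) : HomRel (Paths (GenGraph X))
  | s_sq {n : ℕ} (i : ℕ) (hi : i + 1 < n) :
      Rel R (s i hi ≫ s i hi) (𝟙 (vert X n))
  | e_sq {n : ℕ} (i : Fin n) :
      Rel R (e i ≫ e i) (e i)
  | e_comm {n : ℕ} (i j : Fin n) :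
      Rel R (e i ≫ e j) (e j ≫ e i)
  | s_e_comm {n : ℕ} (i : ℕ) (hi : i + 1 < n) (j : Fin n)
      (h : (j : ℕ) ≠ i) (h' : (j : ℕ) ≠ i + 1) :
      Rel R (s i hi ≫ e j) (e j ≫ s i hi)
  | s_e {n : ℕ} (i : ℕ) (hi : i + 1 < n) :
      Rel R (s i hi ≫ e ⟨i, by omega⟩) (e ⟨i + 1, hi⟩ ≫ s i hi)
  | e_e_s {n : ℕ} (i : ℕ) (hi : i + 1 < n) :
      Rel R (e ⟨i, by omega⟩ ≫ e ⟨i + 1, hi⟩ ≫ s i hi) (e ⟨i, by omega⟩ ≫ e ⟨i + 1, hi⟩)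
  | s_comm {n : ℕ} (i j : ℕ) (hi : i + 1 < n) (hj : j + 1 < n)
      (h : i + 1 < j ∨ j + 1 < i) :
      Rel R (s i hi ≫ s j hj) (s j hj ≫ s i hi)
  | s_braid {n : ℕ} (i j : ℕ) (hi : i + 1 < n) (hj : j + 1 < n)
      (h : i + 1 = j ∨ j + 1 = i) :
      Rel R (s i hi ≫ s j hj ≫ s i hi) (s j hj ≫ s i hi ≫ s j hj)
  | word {n : ℕ} (i : Fin n) (p q : FreeMonoid X) (h : R p q) :
      Rel R (wordPath i p.toList) (wordPath i q.toList)
  | x_comm {n : ℕ} (i j : Fin n) (a b : X) (h : i ≠ j) :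
      Rel R (x a i ≫ x b j) (x b j ≫ x a i)
  | s_x_comm {n : ℕ} (i : ℕ) (hi : i + 1 < n) (j : Fin n) (a : X)
      (h : (j : ℕ) ≠ i) (h' : (j : ℕ) ≠ i + 1) :
      Rel R (s i hi ≫ x a j) (x a j ≫ s i hi)
  | s_x {n : ℕ} (i : ℕ) (hi : i + 1 < n) (a : X) :
      Rel R (s i hi ≫ x a ⟨i, by omega⟩) (x a ⟨i + 1, hi⟩ ≫ s i hi)
  | e_x_comm {n : ℕ} (i j : Fin n) (a : X) (h : i ≠ j) :
      Rel R (e i ≫ x a j) (x a j ≫ e i)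
  | e_x {n : ℕ} (i : Fin n) (a : X) :
      Rel R (e i ≫ x a i) (e i)
  | x_e {n : ℕ} (i : Fin n) (a : X) :
      Rel R (e i) (x a i ≫ e i)
  | lam_rho (n : ℕ) :
      Rel R (lam X n ≫ rho X n) (𝟙 (vert X n))
  | rho_lam (n : ℕ) :
      Rel R (rho X n ≫ lam X n) (e (Fin.last n))
  | s_lam {n : ℕ} (i : ℕ) (hi : i + 1 < n) :
      Rel R (s i hi ≫ lam X n) (lam X n ≫ s i (Nat.lt_succ_of_lt hi))
  | e_lam {n : ℕ} (i : Fin n) :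
      Rel R (e i ≫ lam X n) (lam X n ≫ e i.castSucc)
  | x_lam {n : ℕ} (i : Fin n) (a : X) :
      Rel R (x a i ≫ lam X n) (lam X n ≫ x a i.castSucc)
  | rho_s {n : ℕ} (i : ℕ) (hi : i + 1 < n) :
      Rel R (rho X n ≫ s i hi) (s i (Nat.lt_succ_of_lt hi) ≫ rho X n)
  | rho_e {n : ℕ} (i : Fin n) :
      Rel R (rho X n ≫ e i) (e i.castSucc ≫ rho X n)
  | rho_x {n : ℕ} (i : Fin n) (a : X) :
      Rel R (rho X n ≫ x a i) (x a i.castSucc ≫ rho X n)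

/-! ### The functor from the free category to the wreath product -/

/-- The images of the generators in `M ≀ I`. -/
def genImage {X : Type u} {M : Type v} [Monoid M] (φ : FreeMonoid X →* M) :
    {m n : ℕ} → Gen X m n → WreathHom M m n
  | n, _, .s i hi =>
      .ofPEquiv M (Equiv.swap (⟨i, by omega⟩ : Fin n) ⟨i + 1, hi⟩).toPEquiv
  | _, _, .e i => .ofPEquiv M (PEquiv.ofSet {j | j ≠ i})
  | _, _, .x a i => .single i (φ (FreeMonoid.of a))
  | _, _, .lam n => .ofPEquiv M (incl n)
  | _, _, .rho n => .ofPEquiv M (incl n).symm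

/-- The functor from the free category on the generators to `M ≀ I` that is the identity on objects
and sends each generator to its image. -/
def wreathFunctor {X : Type u} {M : Type v} [Monoid M] (φ : FreeMonoid X →* M) :
    Paths (GenGraph X) ⥤ WreathCat M :=
  Paths.lift
    { obj := fun n : ℕ => (n : ℕ)
      map := fun g => genImage φ g }

end WreathPresentation

namespace WreathPresentation

open CategoryTheory

universe u v

/-! ### The quotient category -/

/-! Let `PresCat R` be the presented category. The relations hold in the wreath product, as a
pointwise check shows, so `presFunctor` from `PresCat R` to it is defined. The task is to show that
this functor is full and faithful, and both follow by induction on the source.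

The tool is an endofunctor `shift` of `PresCat R`, which adds one idle strand at the end. The edges
`ql` and `qr` are natural between the identity and `shift` (`comp_ql`, `shift_comp_qr`), and the
swap `qt` of two added strands is natural on `shift` applied twice (`qt_shift_shift`). With the
cycles `qc`, which take the last point to a chosen place `j`, this yields a normal form
(`isNormal`): a morphism out of `m + 1` either drops the last point and continues as some `f` out of
`m`, or labels the last point by a word `u`, runs `f` beside it, and moves the point to `j`. Out of
`0` there is only one morphism to each object (`eq_qz`).

The value of the image at the last point tells the two forms apart and determines `j` and the
element of `M` represented by `u`; the presentation of `M` then determines the class of `u`. Cutting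
off the last strand recovers `f`, to which induction applies. The same decomposition, read in the
wreath product, gives fullness. -/

theorem congruenceGen_of {C : Type u} [Category.{v} C] {Ω : HomRel C} {a b : C} {p q : a ⟶ b}
    (h : Ω p q) : congruenceGen Ω p q :=
  fun _ _ hΩ => hΩ _ _ h

instance congruence_congruenceGen {C : Type u} [Category.{v} C] (Ω : HomRel C) :
    Congruence (congruenceGen Ω) where
  equivalence :=
    { refl := fun _ _ hσ _ => hσ.equivalence.refl _
      symm := fun h σ hσ hΩ => hσ.equivalence.symm (h σ hσ hΩ)
      trans := fun h h' σ hσ hΩ => hσ.equivalence.trans (h σ hσ hΩ) (h' σ hσ hΩ) }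
  comp_left f _ _ h σ hσ hΩ := HomRel.IsStableUnderPrecomp.comp_left f (h σ hσ hΩ)
  comp_right g h σ hσ hΩ := HomRel.IsStableUnderPostcomp.comp_right g (h σ hσ hΩ)

/-- The kernel of a functor is itself a congruence, so it is one of those being intersected. -/
theorem map_eq_of_congruenceGen {C D : Type*} [Category* C] [Category* D] {Ω : HomRel C}
    (F : C ⥤ D) (hF : ∀ ⦃a b : C⦄ (p q : a ⟶ b), Ω p q → F.map p = F.map q)
    {a b : C} {p q : a ⟶ b} (h : congruenceGen Ω p q) : F.map p = F.map q :=
  h F.homRel inferInstance hF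

/-- The category presented by the generators and the relations. -/
abbrev PresCat {X : Type u} (R : FreeMonoid X → FreeMonoid X → Prop) : Type :=
  Quotient (congruenceGen (Rel R))

/-- The number `n` as an object of the presented category. -/
abbrev pt {X : Type u} (R : FreeMonoid X → FreeMonoid X → Prop) (n : ℕ) : PresCat R :=
  (Quotient.functor (congruenceGen (Rel R))).obj (vert X n)

section
variable {X : Type u} {R : FreeMonoid X → FreeMonoid X → Prop}

variable (R) in
/-- The class of a path in the presented category. -/
def cls {m n : ℕ} (p : vert X m ⟶ vert X n) : pt R m ⟶ pt R n :=
  (Quotient.functor (congruenceGen (Rel R))).map p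

variable (R) in
/-- The class of `s i`. -/
def qs {n : ℕ} (i : ℕ) (hi : i + 1 < n) : pt R n ⟶ pt R n := cls R (s i hi)
variable (R) in
/-- The class of `e i`. -/
def qe {n : ℕ} (i : Fin n) : pt R n ⟶ pt R n := cls R (e i)
variable (R) in
/-- The class of `x a i`. -/
def qx {n : ℕ} (a : X) (i : Fin n) : pt R n ⟶ pt R n := cls R (x a i)
variable (R) in
/-- The class of `lam X n`. -/
def ql (n : ℕ) : pt R n ⟶ pt R (n + 1) := cls R (lam X n)
variable (R) in
/-- The class of `rho X n`. -/
def qr (n : ℕ) : pt R (n + 1) ⟶ pt R n := cls R (rho X n)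
variable (R) in
/-- The class of `wordPath i u`. -/
def qw {n : ℕ} (i : Fin n) (u : List X) : pt R n ⟶ pt R n := cls R (wordPath i u)

theorem cls_comp {l m n : ℕ} (p : vert X l ⟶ vert X m) (q : vert X m ⟶ vert X n) :
    cls R (p ≫ q) = cls R p ≫ cls R q :=
  CategoryTheory.Functor.map_comp _ _ _

theorem cls_id (n : ℕ) : cls R (𝟙 (vert X n)) = 𝟙 (pt R n) :=
  CategoryTheory.Functor.map_id _ _

theorem cls_eq {m n : ℕ} {p q : vert X m ⟶ vert X n} (h : Rel R p q) : cls R p = cls R q :=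
  CategoryTheory.Quotient.sound _ (congruenceGen_of h)

theorem qw_nil {n : ℕ} (i : Fin n) : qw R i [] = 𝟙 _ := cls_id n

theorem qw_cons {n : ℕ} (i : Fin n) (a : X) (u : List X) :
    qw R i (a :: u) = qx R a i ≫ qw R i u := cls_comp _ _

/-! ### The defining relations as equations between classes -/

theorem qs_sq {n : ℕ} (i : ℕ) (hi : i + 1 < n) : qs R i hi ≫ qs R i hi = 𝟙 _ := by
  simpa only [cls_comp, cls_id] using! cls_eq (Rel.s_sq (R := R) i hi)

theorem qe_sq {n : ℕ} (i : Fin n) : qe R i ≫ qe R i = qe R i := by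
  simpa only [cls_comp] using! cls_eq (Rel.e_sq (R := R) i)

theorem qe_comm {n : ℕ} (i j : Fin n) : qe R i ≫ qe R j = qe R j ≫ qe R i := by
  simpa only [cls_comp] using! cls_eq (Rel.e_comm (R := R) i j)

theorem qs_qe_comm {n : ℕ} (i : ℕ) (hi : i + 1 < n) (j : Fin n) (h : (j : ℕ) ≠ i)
    (h' : (j : ℕ) ≠ i + 1) : qs R i hi ≫ qe R j = qe R j ≫ qs R i hi := by
  simpa only [cls_comp] using! cls_eq (Rel.s_e_comm (R := R) i hi j h h')

theorem qs_qe {n : ℕ} (i : ℕ) (hi : i + 1 < n) :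
    qs R i hi ≫ qe R ⟨i, by omega⟩ = qe R ⟨i + 1, hi⟩ ≫ qs R i hi := by
  simpa only [cls_comp] using! cls_eq (Rel.s_e (R := R) i hi)

theorem qe_qe_qs {n : ℕ} (i : ℕ) (hi : i + 1 < n) :
    qe R ⟨i, by omega⟩ ≫ qe R ⟨i + 1, hi⟩ ≫ qs R i hi
      = qe R ⟨i, by omega⟩ ≫ qe R ⟨i + 1, hi⟩ := by
  simpa only [cls_comp] using! cls_eq (Rel.e_e_s (R := R) i hi)

theorem qs_comm {n : ℕ} (i j : ℕ) (hi : i + 1 < n) (hj : j + 1 < n)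
    (h : i + 1 < j ∨ j + 1 < i) : qs R i hi ≫ qs R j hj = qs R j hj ≫ qs R i hi := by
  simpa only [cls_comp] using! cls_eq (Rel.s_comm (R := R) i j hi hj h)

theorem qs_braid {n : ℕ} (i j : ℕ) (hi : i + 1 < n) (hj : j + 1 < n)
    (h : i + 1 = j ∨ j + 1 = i) :
    qs R i hi ≫ qs R j hj ≫ qs R i hi = qs R j hj ≫ qs R i hi ≫ qs R j hj := by
  simpa only [cls_comp] using! cls_eq (Rel.s_braid (R := R) i j hi hj h)

theorem qw_eq {n : ℕ} (i : Fin n) (p q : FreeMonoid X) (h : R p q) :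
    qw R i p.toList = qw R i q.toList :=
  cls_eq (Rel.word (R := R) i p q h)

theorem qx_comm {n : ℕ} (i j : Fin n) (a b : X) (h : i ≠ j) :
    qx R a i ≫ qx R b j = qx R b j ≫ qx R a i := by
  simpa only [cls_comp] using! cls_eq (Rel.x_comm (R := R) i j a b h)

theorem qs_qx_comm {n : ℕ} (i : ℕ) (hi : i + 1 < n) (j : Fin n) (a : X) (h : (j : ℕ) ≠ i)
    (h' : (j : ℕ) ≠ i + 1) : qs R i hi ≫ qx R a j = qx R a j ≫ qs R i hi := by
  simpa only [cls_comp] using! cls_eq (Rel.s_x_comm (R := R) i hi j a h h')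

theorem qs_qx {n : ℕ} (i : ℕ) (hi : i + 1 < n) (a : X) :
    qs R i hi ≫ qx R a ⟨i, by omega⟩ = qx R a ⟨i + 1, hi⟩ ≫ qs R i hi := by
  simpa only [cls_comp] using! cls_eq (Rel.s_x (R := R) i hi a)

theorem qe_qx_comm {n : ℕ} (i j : Fin n) (a : X) (h : i ≠ j) :
    qe R i ≫ qx R a j = qx R a j ≫ qe R i := by
  simpa only [cls_comp] using! cls_eq (Rel.e_x_comm (R := R) i j a h)

theorem qe_qx {n : ℕ} (i : Fin n) (a : X) : qe R i ≫ qx R a i = qe R i := by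
  simpa only [cls_comp] using! cls_eq (Rel.e_x (R := R) i a)

theorem qx_qe {n : ℕ} (i : Fin n) (a : X) : qx R a i ≫ qe R i = qe R i := by
  simpa only [cls_comp] using! (cls_eq (Rel.x_e (R := R) i a)).symm

theorem ql_qr (n : ℕ) : ql R n ≫ qr R n = 𝟙 _ := by
  simpa only [cls_comp, cls_id] using! cls_eq (Rel.lam_rho (R := R) n)

theorem qr_ql (n : ℕ) : qr R n ≫ ql R n = qe R (Fin.last n) := by
  simpa only [cls_comp] using! cls_eq (Rel.rho_lam (R := R) n)

theorem qs_ql {n : ℕ} (i : ℕ) (hi : i + 1 < n) :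
    qs R i hi ≫ ql R n = ql R n ≫ qs R i (Nat.lt_succ_of_lt hi) := by
  simpa only [cls_comp] using! cls_eq (Rel.s_lam (R := R) i hi)

theorem qe_ql {n : ℕ} (i : Fin n) : qe R i ≫ ql R n = ql R n ≫ qe R i.castSucc := by
  simpa only [cls_comp] using! cls_eq (Rel.e_lam (R := R) i)

theorem qx_ql {n : ℕ} (i : Fin n) (a : X) :
    qx R a i ≫ ql R n = ql R n ≫ qx R a i.castSucc := by
  simpa only [cls_comp] using! cls_eq (Rel.x_lam (R := R) i a)

theorem qr_qs {n : ℕ} (i : ℕ) (hi : i + 1 < n) :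
    qr R n ≫ qs R i hi = qs R i (Nat.lt_succ_of_lt hi) ≫ qr R n := by
  simpa only [cls_comp] using! cls_eq (Rel.rho_s (R := R) i hi)

theorem qr_qe {n : ℕ} (i : Fin n) : qr R n ≫ qe R i = qe R i.castSucc ≫ qr R n := by
  simpa only [cls_comp] using! cls_eq (Rel.rho_e (R := R) i)

theorem qr_qx {n : ℕ} (i : Fin n) (a : X) :
    qr R n ≫ qx R a i = qx R a i.castSucc ≫ qr R n := by
  simpa only [cls_comp] using! cls_eq (Rel.rho_x (R := R) i a)

/-- Induction on the length of a path representing a morphism of the presented category. -/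
theorem pres_induction {m : ℕ} (P : ∀ {n : ℕ}, (pt R m ⟶ pt R n) → Prop) (id : P (𝟙 (pt R m)))
    (comp : ∀ {n k : ℕ} (f : pt R m ⟶ pt R n) (g : Gen X n k), P f → P (f ≫ cls R (path g)))
    {n : ℕ} (f : pt R m ⟶ pt R n) : P f := by
  obtain ⟨p, rfl⟩ := (Quotient.functor (congruenceGen (Rel R))).map_surjective f
  refine Paths.induction_fixed_source (V := GenGraph X) (a := vert X m)
    (fun {b} p => P (n := b) (cls R p)) ?_ ?_ p
  · simpa only [cls_id] using id
  · intro n k p g hp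
    exact (congrArg (P (n := k)) (cls_comp (m := n) p (path g))).mpr
      (comp (n := n) (k := k) _ g hp)

/-! ### The swap of the last two points -/

variable (R) in
/-- The class of the last `s` at `n + 2`. -/
def qt (n : ℕ) : pt R (n + 2) ⟶ pt R (n + 2) := qs R n (by omega)

theorem qt_sq (n : ℕ) : qt R n ≫ qt R n = 𝟙 _ := qs_sq _ _

theorem qt_qt_assoc (n : ℕ) {Z : PresCat R} (h : pt R (n + 2) ⟶ Z) : qt R n ≫ qt R n ≫ h = h := by
  rw [← Category.assoc, qt_sq, Category.id_comp]

/-- Conjugation by an involution is an involution. -/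
theorem qt_comp_symm {n : ℕ} {f g : pt R (n + 2) ⟶ pt R (n + 2)}
    (h : qt R n ≫ f = g ≫ qt R n) : qt R n ≫ g = f ≫ qt R n := by
  calc qt R n ≫ g = qt R n ≫ (g ≫ qt R n) ≫ qt R n := by
        rw [Category.assoc, qt_sq, Category.comp_id]
    _ = f ≫ qt R n := by rw [← h, Category.assoc, qt_qt_assoc]

theorem qt_qe_castSucc (n : ℕ) :
    qt R n ≫ qe R (Fin.last n).castSucc = qe R (Fin.last (n + 1)) ≫ qt R n := qs_qe _ _

theorem qt_qe_last (n : ℕ) :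
    qt R n ≫ qe R (Fin.last (n + 1)) = qe R (Fin.last n).castSucc ≫ qt R n := 
  qt_comp_symm (qt_qe_castSucc n)

end

section
variable {X : Type u} {R : FreeMonoid X → FreeMonoid X → Prop}

theorem qe_ql_last (n : ℕ) : ql R n ≫ qe R (Fin.last n) = ql R n := by
  rw [← qr_ql, reassoc_of% ql_qr]

theorem qe_qr_last (n : ℕ) : qe R (Fin.last n) ≫ qr R n = qr R n := by
  rw [← qr_ql, Category.assoc, ql_qr, Category.comp_id]

theorem qt_qs_comm {n : ℕ} (i : ℕ) (hi : i + 1 < n) :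
    qt R n ≫ qs R i (by omega) = qs R i (by omega) ≫ qt R n :=
  qs_comm _ _ _ _ (by omega)

theorem qt_qe_comm {n : ℕ} (i : Fin n) :
    qt R n ≫ qe R i.castSucc.castSucc = qe R i.castSucc.castSucc ≫ qt R n :=
  qs_qe_comm _ _ _ (by simp; omega) (by simp; omega)

theorem qt_qx_comm {n : ℕ} (a : X) (i : Fin n) :
    qt R n ≫ qx R a i.castSucc.castSucc = qx R a i.castSucc.castSucc ≫ qt R n :=
  qs_qx_comm _ _ _ _ (by simp; omega) (by simp; omega)

/-! ### Adding a strand -/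

/-- The sum of a generator with the identity of a point. -/
def shiftGen (R : FreeMonoid X → FreeMonoid X → Prop) :
    {m n : ℕ} → Gen X m n → (pt R (m + 1) ⟶ pt R (n + 1))
  | _, _, .s i hi => qs R i (Nat.lt_succ_of_lt hi)
  | _, _, .e i => qe R i.castSucc
  | _, _, .x a i => qx R a i.castSucc
  -- `ql` creates its point after the idle strand; the swap restores the idle strand to the last
  -- place. The case of `rho` is dual.
  | _, _, .lam n => ql R (n + 1) ≫ qt R n
  | _, _, .rho n => qt R n ≫ qr R (n + 1)

/-- The functor on paths that adds a point. -/
def shiftPaths (R : FreeMonoid X → FreeMonoid X → Prop) : Paths (GenGraph X) ⥤ PresCat R :=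
  Paths.lift
    { obj := fun n : ℕ => pt R (n + 1)
      map := fun g => shiftGen R g }

theorem shiftPaths_path {m n : ℕ} (g : Gen X m n) :
    (shiftPaths R).map (path g) = shiftGen R g :=
  Paths.lift_toPath _ _

theorem shiftPaths_wordPath {n : ℕ} (i : Fin n) (u : List X) :
    (shiftPaths R).map (wordPath i u) = qw R i.castSucc u := by
  induction u with
  | nil => exact ((shiftPaths R).map_id _).trans (qw_nil _).symm
  | cons a u ih =>
    rw [qw_cons, ← ih]
    exact ((shiftPaths R).map_comp _ _).trans (congrArg (· ≫ _) (shiftPaths_path _))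

/-- Relations among loops go to instances of themselves at `n + 1`. In those with `lam` or `rho`,
the additional swaps cancel, conjugate the idempotent at the last point to its neighbour, or commute
with generators away from the last two points. -/
theorem shiftPaths_sound {a b : Paths (GenGraph X)} {p q : a ⟶ b} (h : Rel R p q) :
    (shiftPaths R).map p = (shiftPaths R).map q := by
  cases h
  case word h =>
    rw [shiftPaths_wordPath, shiftPaths_wordPath]
    exact qw_eq _ _ _ h
  all_goals
    simp only [CategoryTheory.Functor.map_comp, CategoryTheory.Functor.map_id, shiftPaths_path]
    dsimp only [shiftGen]
  case s_sq => exact qs_sq _ _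
  case e_sq => exact qe_sq _
  case e_comm => exact qe_comm _ _
  case s_e_comm h h' => exact qs_qe_comm _ _ _ h h'
  case s_e => exact qs_qe _ _
  case e_e_s => exact qe_qe_qs _ _
  case s_comm h => exact qs_comm _ _ _ _ h
  case s_braid h => exact qs_braid _ _ _ _ h
  case x_comm i j a b h => exact qx_comm _ _ _ _ (by simpa using h)
  case s_x_comm h h' => exact qs_qx_comm _ _ _ _ h h'
  case s_x => exact qs_qx _ _ _
  case e_x_comm h => exact qe_qx_comm _ _ _ (by simpa using h)
  case e_x => exact qe_qx _ _
  case x_e => exact (qx_qe _ _).symm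
  case lam_rho n =>
    exact (Category.assoc _ _ _).trans ((congrArg _ (qt_qt_assoc _ _)).trans (ql_qr _))
  case rho_lam n =>
    exact calc
      (qt R n ≫ qr R (n + 1)) ≫ ql R (n + 1) ≫ qt R n
        = qt R n ≫ qe R (Fin.last _) ≫ qt R n := by
          rw [Category.assoc, reassoc_of% qr_ql]
      _ = qe R (Fin.last n).castSucc := by
          rw [← qt_qe_castSucc, qt_qt_assoc]
  case s_lam n i hi =>
    exact calc
      qs R i _ ≫ ql R (n + 1) ≫ qt R n
        = ql R (n + 1) ≫ qs R i _ ≫ qt R n := by rw [reassoc_of% qs_ql]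
      _ = (ql R (n + 1) ≫ qt R n) ≫ qs R i _ := by rw [Category.assoc, qt_qs_comm _ hi]
  case e_lam n i =>
    exact calc
      qe R i.castSucc ≫ ql R (n + 1) ≫ qt R n
        = ql R (n + 1) ≫ qe R i.castSucc.castSucc ≫ qt R n := by rw [reassoc_of% qe_ql]
      _ = (ql R (n + 1) ≫ qt R n) ≫ qe R i.castSucc.castSucc := by
          rw [Category.assoc, qt_qe_comm]
  case x_lam n i a =>
    exact calc
      qx R a i.castSucc ≫ ql R (n + 1) ≫ qt R n
        = ql R (n + 1) ≫ qx R a i.castSucc.castSucc ≫ qt R n := by rw [reassoc_of% qx_ql]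
      _ = (ql R (n + 1) ≫ qt R n) ≫ qx R a i.castSucc.castSucc := by
          rw [Category.assoc, qt_qx_comm]
  case rho_s n i hi =>
    exact calc
      (qt R n ≫ qr R (n + 1)) ≫ qs R i _
        = qt R n ≫ qs R i _ ≫ qr R (n + 1) := by rw [Category.assoc, qr_qs]
      _ = qs R i _ ≫ qt R n ≫ qr R (n + 1) := by rw [reassoc_of% qt_qs_comm _ hi]
  case rho_e n i =>
    exact calc
      (qt R n ≫ qr R (n + 1)) ≫ qe R i.castSucc
        = qt R n ≫ qe R i.castSucc.castSucc ≫ qr R (n + 1) := by rw [Category.assoc, qr_qe]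
      _ = qe R i.castSucc.castSucc ≫ qt R n ≫ qr R (n + 1) := by rw [reassoc_of% qt_qe_comm]
  case rho_x n i a =>
    exact calc
      (qt R n ≫ qr R (n + 1)) ≫ qx R a i.castSucc
        = qt R n ≫ qx R a i.castSucc.castSucc ≫ qr R (n + 1) := by rw [Category.assoc, qr_qx]
      _ = qx R a i.castSucc.castSucc ≫ qt R n ≫ qr R (n + 1) := by rw [reassoc_of% qt_qx_comm]

/-- The functor that adds a point. -/
def shiftFunctor (R : FreeMonoid X → FreeMonoid X → Prop) : PresCat R ⥤ PresCat R :=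
  CategoryTheory.Quotient.lift _ (shiftPaths R) fun _ _ _ _ h =>
    map_eq_of_congruenceGen _ (fun _ _ _ _ h => shiftPaths_sound h) h

/-- The sum of a morphism with the identity of a point. -/
def shift {m n : ℕ} (f : pt R m ⟶ pt R n) : pt R (m + 1) ⟶ pt R (n + 1) :=
  (shiftFunctor R).map f

theorem shift_comp {l m n : ℕ} (f : pt R l ⟶ pt R m) (g : pt R m ⟶ pt R n) :
    shift (f ≫ g) = shift f ≫ shift g :=
  CategoryTheory.Functor.map_comp _ _ _

theorem shift_id (n : ℕ) : shift (𝟙 (pt R n)) = 𝟙 (pt R (n + 1)) :=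
  CategoryTheory.Functor.map_id _ _

theorem shift_path {m n : ℕ} (g : Gen X m n) : shift (cls R (path g)) = shiftGen R g :=
  shiftPaths_path g

theorem shift_qs {n : ℕ} (i : ℕ) (hi : i + 1 < n) :
    shift (qs R i hi) = qs R i (Nat.lt_succ_of_lt hi) := shift_path _

theorem shift_qe {n : ℕ} (i : Fin n) : shift (qe R i) = qe R i.castSucc := shift_path _

theorem shift_qx {n : ℕ} (a : X) (i : Fin n) : shift (qx R a i) = qx R a i.castSucc :=
  shift_path _

theorem shift_ql (n : ℕ) : shift (ql R n) = ql R (n + 1) ≫ qt R n := shift_path _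

theorem shift_qr (n : ℕ) : shift (qr R n) = qt R n ≫ qr R (n + 1) := shift_path _

/-! ### Naturality -/

theorem qe_qe_qt (n : ℕ) :
    qe R (Fin.last n).castSucc ≫ qe R (Fin.last (n + 1)) ≫ qt R n =
      qe R (Fin.last n).castSucc ≫ qe R (Fin.last (n + 1)) := qe_qe_qs _ _

theorem qt_qe_qe (n : ℕ) :
    qt R n ≫ qe R (Fin.last n).castSucc ≫ qe R (Fin.last (n + 1)) =
      qe R (Fin.last n).castSucc ≫ qe R (Fin.last (n + 1)) := by
  rw [reassoc_of% qt_qe_castSucc, qt_qe_last, ← qe_qe_qt, ← Category.assoc, ← Category.assoc,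
    qe_comm]

/-- Neither created point is in the image, so both idempotents can be inserted; they then absorb the
swap in `ql_ql_qt`. -/
theorem ql_ql (n : ℕ) : ql R n ≫ ql R (n + 1) =
    ql R n ≫ ql R (n + 1) ≫ qe R (Fin.last n).castSucc ≫ qe R (Fin.last (n + 1)) := by
  rw [← reassoc_of% qe_ql, reassoc_of% qe_ql_last, qe_ql_last]

theorem ql_ql_qt (n : ℕ) : ql R n ≫ ql R (n + 1) ≫ qt R n = ql R n ≫ ql R (n + 1) := by
  rw [reassoc_of% ql_ql, qe_qe_qt, ← ql_ql]

theorem qr_qr (n : ℕ) : qr R (n + 1) ≫ qr R n =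
    qe R (Fin.last n).castSucc ≫ qe R (Fin.last (n + 1)) ≫ qr R (n + 1) ≫ qr R n := by
  rw [reassoc_of% qe_qr_last, ← reassoc_of% qr_qe, qe_qr_last]

theorem qt_qr_qr (n : ℕ) : qt R n ≫ qr R (n + 1) ≫ qr R n = qr R (n + 1) ≫ qr R n := by
  rw [qr_qr, reassoc_of% qt_qe_qe]

/-- The edges at both ends supply idempotents at the last point. Moving one across the swap turns it
into its neighbour, and the pair absorbs the swap. -/
theorem ql_qt_qr (n : ℕ) : ql R (n + 1) ≫ qt R n ≫ qr R (n + 1) = qr R n ≫ ql R n := by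
  calc ql R (n + 1) ≫ qt R n ≫ qr R (n + 1)
      = (ql R (n + 1) ≫ qe R (Fin.last (n + 1))) ≫ qt R n ≫
          qe R (Fin.last (n + 1)) ≫ qr R (n + 1) := by rw [qe_ql_last, qe_qr_last]
    _ = ql R (n + 1) ≫ qe R (Fin.last (n + 1)) ≫ qe R (Fin.last n).castSucc ≫
          qt R n ≫ qr R (n + 1) := by rw [Category.assoc, reassoc_of% qt_qe_last]
    _ = ql R (n + 1) ≫ qe R (Fin.last n).castSucc ≫ qe R (Fin.last (n + 1)) ≫
          qr R (n + 1) := by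
        rw [reassoc_of% qe_comm (Fin.last (n + 1)), reassoc_of% qe_qe_qt]
    _ = qr R n ≫ ql R n := by
        rw [qe_qr_last, ← reassoc_of% qe_ql, ql_qr, Category.comp_id, qr_ql]

/-- Naturality need only be checked on generators. Loops are covered by the defining relations;
`lam` and `rho` need the absorption of the swap. -/
theorem comp_ql {m n : ℕ} (f : pt R m ⟶ pt R n) : f ≫ ql R n = ql R m ≫ shift f := by
  induction f using pres_induction with
  | id => rw [shift_id, Category.id_comp, Category.comp_id]
  | comp f g ih =>
    rw [Category.assoc, shift_comp, shift_path, ← reassoc_of% ih]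
    congr 1
    cases g with
    | s i hi => exact qs_ql i hi
    | e i => exact qe_ql i
    | x a i => exact qx_ql i a
    | lam => exact (ql_ql_qt _).symm
    | rho => exact (ql_qt_qr _).symm

theorem shift_comp_qr {m n : ℕ} (f : pt R m ⟶ pt R n) : shift f ≫ qr R n = qr R m ≫ f := by
  induction f using pres_induction with
  | id => rw [shift_id, Category.id_comp, Category.comp_id]
  | comp f g ih =>
    rw [shift_comp, shift_path, Category.assoc, ← reassoc_of% ih]
    congr 1
    cases g with
    | s i hi => exact (qr_qs i hi).symm
    | e i => exact (qr_qe i).symm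
    | x a i => exact (qr_qx i a).symm
    | lam => exact (Category.assoc _ _ _).trans (ql_qt_qr _)
    | rho => exact (Category.assoc _ _ _).trans (qt_qr_qr _)

/-- Two idle strands may be crossed before or after `f`. The cases of `lam` and `rho` rest on the
braid relation, since there the new or vanishing point crosses both strands. -/
theorem qt_shift_shift {m n : ℕ} (f : pt R m ⟶ pt R n) :
    qt R m ≫ shift (shift f) = shift (shift f) ≫ qt R n := by
  induction f using pres_induction with
  | id => simp only [shift_id, Category.id_comp, Category.comp_id]
  | comp f g ih =>
    rw [shift_comp, shift_comp, reassoc_of% ih, Category.assoc]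
    congr 1
    cases g with
    | s i hi =>
      change qt R _ ≫ shift (shift (qs R i hi)) = shift (shift (qs R i hi)) ≫ qt R _
      rw [shift_qs, shift_qs, qt_qs_comm _ hi]
    | e i =>
      change qt R _ ≫ shift (shift (qe R i)) = shift (shift (qe R i)) ≫ qt R _
      rw [shift_qe, shift_qe, qt_qe_comm]
    | x a i =>
      change qt R _ ≫ shift (shift (qx R a i)) = shift (shift (qx R a i)) ≫ qt R _
      rw [shift_qx, shift_qx, qt_qx_comm]
    | lam =>
      rename_i n
      change qt R n ≫ shift (shift (ql R n)) = shift (shift (ql R n)) ≫ qt R (n + 1)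
      have hb : qs R n (by omega) ≫ qt R (n + 1) ≫ qs R n (by omega) =
          qt R (n + 1) ≫ qs R n (by omega) ≫ qt R (n + 1) := qs_braid _ _ _ _ (by omega)
      have hs : shift (qt R n) = qs R n (by omega) := shift_qs _ _
      have hl : qt R n ≫ ql R (n + 2) = ql R (n + 2) ≫ qs R n (by omega) := qs_ql _ _
      rw [shift_ql, shift_comp, shift_ql, hs, Category.assoc, reassoc_of% hl, hb]
      simp only [Category.assoc]
    | rho =>
      rename_i n
      change qt R (n + 1) ≫ shift (shift (qr R n)) = shift (shift (qr R n)) ≫ qt R n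
      have hb : qs R n (by omega) ≫ qt R (n + 1) ≫ qs R n (by omega) =
          qt R (n + 1) ≫ qs R n (by omega) ≫ qt R (n + 1) := qs_braid _ _ _ _ (by omega)
      have hs : shift (qt R n) = qs R n (by omega) := shift_qs _ _
      have hr : qr R (n + 2) ≫ qt R n = qs R n (by omega) ≫ qr R (n + 2) := qr_qs _ _
      rw [shift_qr, shift_comp, shift_qr, hs, Category.assoc, Category.assoc, hr,
        reassoc_of% hb]

end

section
variable {X : Type u} {R : FreeMonoid X → FreeMonoid X → Prop}

/-! ### Moving the last point -/

/-- A family of endomorphisms, one for each of the `n` points, that behaves like the generators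
`e i` and like the generators `x a i`. -/
structure IsLocal (y : ∀ n : ℕ, Fin n → (pt R n ⟶ pt R n)) : Prop where
  shift_eq : ∀ (n : ℕ) (i : Fin n), shift (y n i) = y (n + 1) i.castSucc
  qt_comp : ∀ n : ℕ, qt R n ≫ y (n + 2) (Fin.last n).castSucc = y (n + 2) (Fin.last _) ≫ qt R n
  comm_qs : ∀ (n i : ℕ) (hi : i + 1 < n),
    y (n + 1) (Fin.last n) ≫ shift (qs R i hi) = shift (qs R i hi) ≫ y (n + 1) (Fin.last n)
  comm_qe : ∀ (n : ℕ) (i : Fin n),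
    y (n + 1) (Fin.last n) ≫ shift (qe R i) = shift (qe R i) ≫ y (n + 1) (Fin.last n)
  comm_qx : ∀ (n : ℕ) (a : X) (i : Fin n),
    y (n + 1) (Fin.last n) ≫ shift (qx R a i) = shift (qx R a i) ≫ y (n + 1) (Fin.last n)

theorem isLocal_qe : IsLocal (R := R) (fun _ i => qe R i) where
  shift_eq _ i := shift_qe i
  qt_comp n := qt_qe_castSucc n
  comm_qs n i hi := by
    rw [shift_qs]
    exact (qs_qe_comm _ _ _ (by simp; omega) (by simp; omega)).symm
  comm_qe n i := by rw [shift_qe, qe_comm]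
  comm_qx n a i := by
    rw [shift_qx]
    exact qe_qx_comm _ _ _ (Fin.castSucc_lt_last i).ne'

theorem isLocal_qx (a : X) : IsLocal (R := R) (fun _ i => qx R a i) where
  shift_eq _ i := shift_qx a i
  qt_comp n := qs_qx _ _ _
  comm_qs n i hi := by
    rw [shift_qs]
    exact (qs_qx_comm _ _ _ _ (by simp; omega) (by simp; omega)).symm
  comm_qe n i := by
    rw [shift_qe]
    exact (qe_qx_comm _ _ _ (Fin.castSucc_lt_last i).ne).symm
  comm_qx n b i := by
    rw [shift_qx]
    exact qx_comm _ _ _ _ (Fin.castSucc_lt_last i).ne'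

/-- What happens on the idle strand slides past what happens on the others. For `lam` and `rho`, the
swap carries `y` to the neighbouring point, where naturality of `ql` and `qr` applies. -/
theorem IsLocal.comm {y : ∀ n : ℕ, Fin n → (pt R n ⟶ pt R n)} (hy : IsLocal y) {m n : ℕ}
    (f : pt R m ⟶ pt R n) :
    y (m + 1) (Fin.last m) ≫ shift f = shift f ≫ y (n + 1) (Fin.last n) := by
  induction f using pres_induction with
  | id => rw [shift_id, Category.id_comp, Category.comp_id]
  | comp f g ih =>
    rw [shift_comp, reassoc_of% ih, Category.assoc]
    congr 1
    cases g with
    | s i hi => exact hy.comm_qs _ i hi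
    | e i => exact hy.comm_qe _ i
    | x a i => exact hy.comm_qx _ a i
    | lam =>
      rename_i n
      change _ ≫ shift (ql R n) = shift (ql R n) ≫ _
      rw [shift_ql, Category.assoc, qt_comp_symm (hy.qt_comp n), ← hy.shift_eq, ← reassoc_of% comp_ql]
    | rho =>
      rename_i n
      change _ ≫ shift (qr R n) = shift (qr R n) ≫ _
      rw [shift_qr, Category.assoc, ← shift_comp_qr, hy.shift_eq, reassoc_of% hy.qt_comp]

variable (R) in
/-- The cycle that moves the last point to `j` and preserves the order of the other points. -/
def qc : (n : ℕ) → Fin (n + 1) → (pt R (n + 1) ⟶ pt R (n + 1))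
  | 0, _ => 𝟙 _
  | n + 1, j => Fin.lastCases (𝟙 _) (fun j' => qt R n ≫ shift (qc n j')) j

theorem qc_last (n : ℕ) : qc R n (Fin.last n) = 𝟙 _ := by
  cases n with
  | zero => rfl
  | succ n => simp [qc]

theorem qc_castSucc {n : ℕ} (j : Fin (n + 1)) :
    qc R (n + 1) j.castSucc = qt R n ≫ shift (qc R n j) := by
  simp [qc]

theorem IsLocal.qc_self {y : ∀ n : ℕ, Fin n → (pt R n ⟶ pt R n)} (hy : IsLocal y) {n : ℕ}
    (j : Fin (n + 1)) :
    qc R n j ≫ y (n + 1) j = y (n + 1) (Fin.last n) ≫ qc R n j := by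
  induction n with
  | zero =>
    obtain rfl : j = Fin.last 0 := Fin.ext (by omega)
    rw [qc_last, Category.id_comp, Category.comp_id]
  | succ n ih =>
    induction j using Fin.lastCases with
    | last => rw [qc_last, Category.id_comp, Category.comp_id]
    | cast j =>
      rw [qc_castSucc, ← hy.shift_eq, Category.assoc, ← shift_comp, ih, shift_comp, hy.shift_eq,
        reassoc_of% hy.qt_comp]

/-- The point `i'` is the preimage of `i` under the cycle; it is not the last point because `i ≠ j`.
-/
theorem IsLocal.qc_ne {y : ∀ n : ℕ, Fin n → (pt R n ⟶ pt R n)} (hy : IsLocal y) {n : ℕ}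
    {i j : Fin (n + 1)} (h : i ≠ j) :
    ∃ i' : Fin n, qc R n j ≫ y (n + 1) i = shift (y n i') ≫ qc R n j := by
  induction n with
  | zero => exact absurd (Fin.ext (by omega)) h
  | succ n ih =>
    induction j using Fin.lastCases with
    | last =>
      induction i using Fin.lastCases with
      | last => exact absurd rfl h
      | cast i =>
        exact ⟨i, by rw [qc_last, Category.id_comp, Category.comp_id, hy.shift_eq]⟩
    | cast j =>
      induction i using Fin.lastCases with
      | last =>
        refine ⟨Fin.last n, ?_⟩
        rw [qc_castSucc, Category.assoc, ← hy.comm, hy.shift_eq,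
          reassoc_of% qt_comp_symm (hy.qt_comp n)]
      | cast i =>
        obtain ⟨i', hi'⟩ := ih (i := i) (j := j) (fun hij => h (by rw [hij]))
        refine ⟨i'.castSucc, ?_⟩
        rw [qc_castSucc, ← hy.shift_eq, Category.assoc, ← shift_comp, hi', shift_comp,
          reassoc_of% qt_shift_shift, ← hy.shift_eq n i']

/-- The cycles act as coset representatives for the permutations that fix the last point: an
adjacent transposition either changes the representative or passes through as a transposition of the
other points. -/
theorem qc_qs {n : ℕ} (j : Fin (n + 1)) (i : ℕ) (hi : i + 1 < n + 1) :
    (∃ j', qc R n j ≫ qs R i hi = qc R n j') ∨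
      ∃ (i' : ℕ) (hi' : i' + 1 < n), qc R n j ≫ qs R i hi = shift (qs R i' hi') ≫ qc R n j := by
  induction n generalizing i with
  | zero => omega
  | succ n ih =>
    obtain rfl | hin : i = n ∨ i + 1 < n + 1 := by omega
    · change (∃ j', qc R (i + 1) j ≫ qt R i = qc R (i + 1) j') ∨
        ∃ (i' : ℕ) (hi' : i' + 1 < i + 1),
          qc R (i + 1) j ≫ qt R i = shift (qs R i' hi') ≫ qc R (i + 1) j
      induction j using Fin.lastCases with
      | last =>
        refine Or.inl ⟨(Fin.last i).castSucc, ?_⟩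
        rw [qc_last, qc_castSucc, qc_last, shift_id, Category.id_comp, Category.comp_id]
      | cast j =>
        induction j using Fin.lastCases with
        | last =>
          refine Or.inl ⟨Fin.last _, ?_⟩
          rw [qc_castSucc, qc_last, qc_last, shift_id, Category.comp_id, qt_sq]
        | cast j =>
          -- Here `j` lies below both swapped points, and the braid relation turns the top
          -- transposition into the one just below it.
          obtain _ | n := i
          · exact j.elim0
          refine Or.inr ⟨n, by omega, ?_⟩
          have hb : qt R (n + 1) ≫ shift (qt R n) ≫ qt R (n + 1) =
              shift (qt R n) ≫ qt R (n + 1) ≫ shift (qt R n) := by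
            have hs : shift (qt R n) = qs R n (by omega) := shift_qs _ _
            rw [hs]
            exact qs_braid _ _ _ _ (by omega)
          change _ = shift (qt R n) ≫ _
          rw [qc_castSucc, qc_castSucc, shift_comp]
          simp only [Category.assoc]
          rw [← qt_shift_shift, reassoc_of% hb]
    · induction j using Fin.lastCases with
      | last =>
        refine Or.inr ⟨i, hin, ?_⟩
        rw [qc_last, Category.id_comp, Category.comp_id, shift_qs]
      | cast j =>
        have h : qc R (n + 1) j.castSucc ≫ qs R i hi = qt R n ≫ shift (qc R n j ≫ qs R i hin) := by
          rw [qc_castSucc, shift_comp, shift_qs, Category.assoc]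
        rw [h]
        obtain ⟨j', h'⟩ | ⟨i', hi', h'⟩ := ih j i hin
        · exact Or.inl ⟨j'.castSucc, by rw [h', qc_castSucc]⟩
        · refine Or.inr ⟨i', by omega, ?_⟩
          rw [h', shift_comp, reassoc_of% qt_shift_shift, shift_qs, qc_castSucc]

theorem exists_qc_comp_qc_eq_id {n : ℕ} (j : Fin (n + 1)) :
    ∃ d, qc R n j ≫ d = 𝟙 _ ∧ d ≫ qc R n j = 𝟙 _ := by
  induction n with
  | zero => exact ⟨𝟙 _, Category.id_comp _, Category.id_comp _⟩
  | succ n ih =>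
    induction j using Fin.lastCases with
    | last => exact ⟨𝟙 _, by rw [qc_last, Category.id_comp], by rw [qc_last, Category.id_comp]⟩
    | cast j =>
      obtain ⟨d, h, h'⟩ := ih j
      refine ⟨shift d ≫ qt R n, ?_, ?_⟩
      · rw [qc_castSucc, Category.assoc, ← Category.assoc (shift _), ← shift_comp, h, shift_id,
          Category.id_comp, qt_sq]
      · rw [qc_castSucc, Category.assoc, qt_qt_assoc, ← shift_comp, h', shift_id]

/-! ### Normal forms -/

variable (R) in
/-- The morphism from `0` to `n`. -/
def qz : (n : ℕ) → (pt R 0 ⟶ pt R n)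
  | 0 => 𝟙 _
  | n + 1 => qz n ≫ ql R n

theorem qz_qe {n : ℕ} (i : Fin n) : qz R n ≫ qe R i = qz R n := by
  induction n with
  | zero => exact i.elim0
  | succ n ih =>
    induction i using Fin.lastCases with
    | last => rw [qz, Category.assoc, qe_ql_last]
    | cast i => rw [qz, Category.assoc, ← qe_ql, reassoc_of% ih]

/-- The morphism from `0` absorbs all idempotents `qe`, and these absorb letters and, in adjacent
pairs, transpositions. Hence `0` is initial. -/
theorem qz_comp {m n : ℕ} (f : pt R m ⟶ pt R n) : qz R m ≫ f = qz R n := by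
  induction f using pres_induction with
  | id => rw [Category.comp_id]
  | comp f g ih =>
    rw [reassoc_of% ih]
    cases g with
    | s i hi =>
      change qz R _ ≫ qs R i hi = _
      have h := congrArg (qz R _ ≫ ·) (qe_qe_qs (R := R) i hi)
      simpa only [reassoc_of% qz_qe, qz_qe] using h
    | e i => exact qz_qe i
    | x a i =>
      change qz R _ ≫ qx R a i = _
      have h := congrArg (qz R _ ≫ ·) (qe_qx (R := R) i a)
      simpa only [reassoc_of% qz_qe, qz_qe] using h
    | lam => rfl
    | rho =>
      rename_i n
      change qz R (n + 1) ≫ qr R n = _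
      rw [qz, Category.assoc, ql_qr, Category.comp_id]

theorem eq_qz {n : ℕ} (f : pt R 0 ⟶ pt R n) : f = qz R n := by
  rw [← qz_comp f, qz, Category.id_comp]

/-! ### Words on a single point -/

theorem qw_concat {n : ℕ} (i : Fin n) (u : List X) (a : X) :
    qw R i (u ++ [a]) = qw R i u ≫ qx R a i := by
  induction u with
  | nil => rw [List.nil_append, qw_cons, qw_nil, Category.id_comp, Category.comp_id]
  | cons b u ih => rw [List.cons_append, qw_cons, qw_cons, ih, Category.assoc]

theorem qw_qe {n : ℕ} (i : Fin n) (u : List X) : qw R i u ≫ qe R i = qe R i := by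
  induction u with
  | nil => rw [qw_nil, Category.id_comp]
  | cons b u ih => rw [qw_cons, Category.assoc, ih, qx_qe]

theorem qe_qw {n : ℕ} (i : Fin n) (u : List X) : qe R i ≫ qw R i u = qe R i := by
  induction u with
  | nil => rw [qw_nil, Category.comp_id]
  | cons b u ih => rw [qw_cons, reassoc_of% qe_qx, ih]

theorem qw_qr (n : ℕ) (u : List X) : qw R (Fin.last n) u ≫ qr R n = qr R n := by
  rw [← qe_qr_last, reassoc_of% qw_qe]

theorem ql_qw (n : ℕ) (u : List X) : ql R n ≫ qw R (Fin.last n) u = ql R n := by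
  rw [← qe_ql_last, Category.assoc, qe_qw]

variable (R) in
/-- Normal forms at a nonempty source: the last point of the source is either outside the domain,
or is sent to a point `j` with a word as its label. -/
inductive IsNormal (m : ℕ) : ∀ {n : ℕ}, (pt R (m + 1) ⟶ pt R n) → Prop
  | none {n : ℕ} (f : pt R m ⟶ pt R n) : IsNormal m (qr R m ≫ f)
  | some {n : ℕ} (f : pt R m ⟶ pt R n) (u : List X) (j : Fin (n + 1)) :
    IsNormal m (qw R (Fin.last m) u ≫ shift f ≫ qc R n j)

theorem isNormal_id (m : ℕ) : IsNormal R m (𝟙 _) := by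
  have h := IsNormal.some (𝟙 (pt R m)) [] (Fin.last m)
  rwa [qw_nil, shift_id, qc_last, Category.id_comp, Category.id_comp] at h

/-- A generator is pushed left through the cycle. If it acts away from `j`, it joins `f`; if it acts
at `j`, it reaches the last strand and extends the word or deletes the point; otherwise it alters
the cycle. -/
theorem IsNormal.comp_gen {m n k : ℕ} {f : pt R (m + 1) ⟶ pt R n} (hf : IsNormal R m f)
    (g : Gen X n k) : IsNormal R m (f ≫ cls R (path g)) := by
  cases hf with
  | none f =>
    rw [Category.assoc]
    exact .none _
  | @some n f u j =>
    simp only [Category.assoc]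
    cases g with
    | s i hi =>
      change IsNormal R m (_ ≫ _ ≫ _ ≫ qs R i hi)
      obtain ⟨j', h⟩ | ⟨i', hi', h⟩ := qc_qs (R := R) j i hi
      · rw [h]
        exact .some f u j'
      · rw [h, ← Category.assoc (shift f), ← shift_comp]
        exact .some _ u j
    | e i =>
      change IsNormal R m (_ ≫ _ ≫ _ ≫ qe R i)
      by_cases h : i = j
      · subst h
        -- The idempotent reaches the last point of the source, swallows the word, and factors
        -- through `qr`, which gives the first normal form.
        rw [isLocal_qe.qc_self, ← reassoc_of% isLocal_qe.comm, reassoc_of% qw_qe, ← qr_ql,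
          Category.assoc]
        exact .none _
      · obtain ⟨i', h⟩ := isLocal_qe.qc_ne (R := R) h
        rw [h, ← Category.assoc (shift f), ← shift_comp]
        exact .some _ u j
    | x a i =>
      change IsNormal R m (_ ≫ _ ≫ _ ≫ qx R a i)
      by_cases h : i = j
      · subst h
        rw [(isLocal_qx a).qc_self, ← reassoc_of% (isLocal_qx a).comm, ← Category.assoc,
          ← qw_concat]
        exact .some _ _ _
      · obtain ⟨i', h⟩ := (isLocal_qx (R := R) a).qc_ne h
        rw [h, ← Category.assoc (shift f), ← shift_comp]
        exact .some _ u j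
    | lam =>
      change IsNormal R m (_ ≫ _ ≫ _ ≫ ql R _)
      have h : shift f ≫ qc R n j ≫ ql R (n + 1) =
          shift (f ≫ ql R n) ≫ qc R (n + 1) j.castSucc := by
        rw [comp_ql (qc R n j), qc_castSucc, shift_comp, shift_ql, Category.assoc, Category.assoc,
          qt_qt_assoc]
      rw [h]
      exact .some _ u j.castSucc
    | rho =>
      change IsNormal R m (_ ≫ _ ≫ _ ≫ qr R k)
      induction j using Fin.lastCases with
      | last =>
        rw [qc_last, Category.id_comp, shift_comp_qr, reassoc_of% qw_qr]
        exact .none f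
      | cast j =>
        obtain _ | k := k
        · exact j.elim0
        have h : shift f ≫ qc R (k + 1) j.castSucc ≫ qr R (k + 1) =
            shift (f ≫ qr R k) ≫ qc R k j := by
          rw [qc_castSucc, shift_comp, shift_qr, Category.assoc, Category.assoc, Category.assoc,
            shift_comp_qr]
        rw [h]
        exact .some _ u j

theorem isNormal {m n : ℕ} (f : pt R (m + 1) ⟶ pt R n) : IsNormal R m f := by
  induction f using pres_induction with
  | id => exact isNormal_id m
  | comp f g ih => exact ih.comp_gen g

end

section
variable {X : Type u} {R : FreeMonoid X → FreeMonoid X → Prop} {M : Type v}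

/-! ### Evaluation of morphisms of the wreath product -/

namespace WreathHom

/-- The label and the image of a point, if it lies in the domain. -/
def eval {m n : ℕ} (f : WreathHom M m n) (i : Fin m) : Option (M × Fin n) :=
  (f.map i).bind fun j => WithZero.recZeroCoe none (fun a => some (a, j)) (f.label i)

theorem eval_cases {m n : ℕ} (f : WreathHom M m n) (i : Fin m) :
    (f.map i = none ∧ f.label i = 0 ∧ f.eval i = none) ∨
      ∃ (a : M) (j : Fin n), f.map i = some j ∧ f.label i = a ∧ f.eval i = some (a, j) := by
  have h := f.supp i
  cases hm : f.map i with
  | none => simp_all [eval]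
  | some j =>
    rw [hm] at h
    obtain ⟨a, ha⟩ := WithZero.ne_zero_iff_exists.mp (h.mpr rfl)
    exact .inr ⟨a, j, rfl, ha.symm, by simp [eval, hm, ← ha]⟩

/-- The support condition makes label and map vanish together, so the combined partial value loses
nothing. -/
theorem ext_eval {m n : ℕ} {f g : WreathHom M m n} (h : ∀ i, f.eval i = g.eval i) : f = g := by
  have key (i : Fin m) : f.label i = g.label i ∧ f.map i = g.map i := by
    have := h i
    obtain ⟨h₁, h₂, h₃⟩ | ⟨a, j, h₁, h₂, h₃⟩ := f.eval_cases i <;>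
    obtain ⟨h₁', h₂', h₃'⟩ | ⟨b, k, h₁', h₂', h₃'⟩ := g.eval_cases i <;>
    simp_all
  exact WreathHom.ext (funext fun i => (key i).1) (PEquiv.ext fun i => (key i).2)

theorem eval_injOn {m n : ℕ} (f : WreathHom M m n) {i i' : Fin m} {a a' : M} {j : Fin n}
    (h : f.eval i = some (a, j)) (h' : f.eval i' = some (a', j)) : i = i' := by
  have key {i : Fin m} {a : M} (h : f.eval i = some (a, j)) : j ∈ f.map i := by
    obtain ⟨h₁, h₂, h₃⟩ | ⟨a, j, h₁, h₂, h₃⟩ := f.eval_cases i <;> simp_all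
  exact f.map.inj (key h) (key h')

variable [Monoid M]

theorem eval_id {n : ℕ} (i : Fin n) : (WreathHom.id M n).eval i = some (1, i) := by
  simp [eval, WreathHom.id, ← WithZero.coe_one]

theorem eval_comp {m n k : ℕ} (f : WreathHom M m n) (g : WreathHom M n k) (i : Fin m) :
    (f.comp g).eval i =
      (f.eval i).bind fun p => (g.eval p.2).map fun q => (p.1 * q.1, q.2) := by
  obtain ⟨h₁, h₂, h₃⟩ | ⟨a, j, h₁, h₂, h₃⟩ := f.eval_cases i
  · rw [h₃]
    simp [eval, comp, h₁, PEquiv.trans]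
  · rw [h₃]
    obtain ⟨h₁', h₂', h₃'⟩ | ⟨b, k, h₁', h₂', h₃'⟩ := g.eval_cases j
    · simp [eval, comp, h₁, PEquiv.trans, h₁']
    · simp [eval, comp, h₁, PEquiv.trans, h₁', h₂, act, h₂', ← WithZero.coe_mul]

theorem eval_ofPEquiv {m n : ℕ} (α : Fin m ≃. Fin n) (i : Fin m) :
    (ofPEquiv M α).eval i = (α i).map fun j => (1, j) := by
  cases h : α i <;> simp [eval, ofPEquiv, act, h, ← WithZero.coe_one]

theorem eval_single {n : ℕ} (i : Fin n) (a : M) (j : Fin n) :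
    (single i a).eval j = some (if j = i then a else 1, j) := by
  by_cases h : j = i
  · subst h; simp [eval, single]
  · simp [eval, single, h, ← WithZero.coe_one]

end WreathHom

variable [Monoid M]

theorem eval_genImage_s (φ : FreeMonoid X →* M) {n : ℕ} (i : ℕ) (hi : i + 1 < n) (k : Fin n) :
    (genImage φ (.s i hi : Gen X n n)).eval k = some (1,
      if (k : ℕ) = i then ⟨i + 1, hi⟩ else if (k : ℕ) = i + 1 then ⟨i, by omega⟩ else k) := by
  simp only [genImage, WreathHom.eval_ofPEquiv, Equiv.toPEquiv_apply, Option.map_some,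
    Equiv.swap_apply_def, Fin.ext_iff]

theorem eval_genImage_e (φ : FreeMonoid X →* M) {n : ℕ} (i k : Fin n) :
    (genImage φ (.e i : Gen X n n)).eval k = if k = i then none else some (1, k) := by
  by_cases h : k = i <;> simp [genImage, WreathHom.eval_ofPEquiv, PEquiv.ofSet, h]

theorem eval_genImage_x (φ : FreeMonoid X →* M) {n : ℕ} (a : X) (i k : Fin n) :
    (genImage φ (.x a i : Gen X n n)).eval k =
      some (if k = i then φ (FreeMonoid.of a) else 1, k) :=
  WreathHom.eval_single _ _ _

theorem eval_genImage_lam (φ : FreeMonoid X →* M) {n : ℕ} (k : Fin n) :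
    (genImage φ (.lam n : Gen X n (n + 1))).eval k = some (1, k.castSucc) := by
  simp [genImage, WreathHom.eval_ofPEquiv, incl]

theorem eval_genImage_rho (φ : FreeMonoid X →* M) {n : ℕ} (k : Fin (n + 1)) :
    (genImage φ (.rho n : Gen X (n + 1) n)).eval k =
      if h : (k : ℕ) < n then some (1, ⟨k, h⟩) else none := by
  have h : (incl n).symm k = if h : (k : ℕ) < n then some ⟨k, h⟩ else none := rfl
  by_cases hk : (k : ℕ) < n <;> simp [genImage, WreathHom.eval_ofPEquiv, h, hk]

/-! ### Soundness -/

/-- Evaluation of the image of a path. -/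
def pathEval (φ : FreeMonoid X →* M) {m n : ℕ} (p : vert X m ⟶ vert X n) (i : Fin m) :
    Option (M × Fin n) :=
  WreathHom.eval ((wreathFunctor φ).map p) i

theorem pathEval_comp (φ : FreeMonoid X →* M) {l m n : ℕ} (p : vert X l ⟶ vert X m)
    (q : vert X m ⟶ vert X n) (i : Fin l) :
    pathEval φ (p ≫ q) i =
      (pathEval φ p i).bind fun r => (pathEval φ q r.2).map fun t => (r.1 * t.1, t.2) :=
  (congrArg (WreathHom.eval · i) ((wreathFunctor φ).map_comp p q)).trans
    (WreathHom.eval_comp _ _ _)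

theorem pathEval_id (φ : FreeMonoid X →* M) {n : ℕ} (i : Fin n) :
    pathEval φ (𝟙 (vert X n)) i = some (1, i) :=
  (congrArg (WreathHom.eval · i) ((wreathFunctor φ).map_id _)).trans (WreathHom.eval_id _)

theorem pathEval_path (φ : FreeMonoid X →* M) {m n : ℕ} (g : Gen X m n) (i : Fin m) :
    pathEval φ (path g) i = (genImage φ g).eval i :=
  congrArg (WreathHom.eval · i) (Paths.lift_toPath _ _)

theorem pathEval_wordPath (φ : FreeMonoid X →* M) {n : ℕ} (u : FreeMonoid X) (i j : Fin n) :
    pathEval φ (wordPath i u.toList) j = some (if j = i then φ u else 1, j) := by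
  induction u using FreeMonoid.inductionOn' with
  | one => simp [wordPath, pathEval_id]
  | of_mul a u ih =>
    rw [FreeMonoid.toList_of_mul, wordPath, pathEval_comp, pathEval_path, eval_genImage_x,
      Option.bind_some, ih]
    by_cases h : j = i <;> simp [h]

theorem pathEval_eq_of_rel (φ : FreeMonoid X →* M) (hR : ∀ u v, R u v → φ u = φ v)
    {m n : ℕ} {p q : vert X m ⟶ vert X n} (h : Rel R p q) (k : Fin m) :
    pathEval φ p k = pathEval φ q k := by
  have hk := k.isLt
  cases h
  case word => rw [pathEval_wordPath, pathEval_wordPath, hR _ _ ‹_›]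
  all_goals
    simp only [pathEval_comp, pathEval_path, pathEval_id, eval_genImage_s, eval_genImage_e,
      eval_genImage_x, eval_genImage_lam, eval_genImage_rho, Option.bind_some, Option.map_some,
      one_mul, mul_one, Fin.ext_iff, Fin.val_castSucc]
  case s_sq i hi =>
    by_cases h₁ : (k : ℕ) = i <;> by_cases h₂ : (k : ℕ) = i + 1 <;> simp [h₁, h₂, Fin.ext_iff]
  case e_sq i => by_cases h₁ : (k : ℕ) = i <;> simp [h₁]
  case e_comm i j =>
    by_cases h₁ : (k : ℕ) = i <;> by_cases h₂ : (k : ℕ) = j <;> by_cases h₃ : (i : ℕ) = j <;>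
      simp_all
  case s_e_comm i hi j h h' =>
    by_cases h₁ : (k : ℕ) = i <;> by_cases h₂ : (k : ℕ) = i + 1 <;>
      by_cases h₃ : (k : ℕ) = j <;> simp_all [eq_comm]
  case s_e i hi =>
    by_cases h₁ : (k : ℕ) = i <;> by_cases h₂ : (k : ℕ) = i + 1 <;> simp [h₁, h₂]
  case e_e_s i hi =>
    by_cases h₁ : (k : ℕ) = i <;> by_cases h₂ : (k : ℕ) = i + 1 <;> simp [h₁, h₂]
  case s_comm i j h hi hj =>
    have h₀ : i ≠ j ∧ i ≠ j + 1 ∧ i + 1 ≠ j ∧ j ≠ i ∧ j ≠ i + 1 ∧ j + 1 ≠ i := by omega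
    by_cases h₁ : (k : ℕ) = i
    · simp [h₁, h₀]
    by_cases h₂ : (k : ℕ) = i + 1
    · simp [h₂, h₀]
    by_cases h₃ : (k : ℕ) = j
    · simp [h₃, h₀]
    by_cases h₄ : (k : ℕ) = j + 1 <;> simp [h₁, h₂, h₃, h₄, h₀]
  case s_braid i j h hi hj =>
    have h₀ (l : ℕ) : l ≠ l + 1 + 1 ∧ l + 1 + 1 ≠ l := by omega
    obtain rfl | rfl := h
    · by_cases h₁ : (k : ℕ) = i
      · simp [h₀, h₁]
      by_cases h₂ : (k : ℕ) = i + 1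
      · simp [h₀, h₂]
      by_cases h₃ : (k : ℕ) = i + 1 + 1 <;> simp [h₀, h₁, h₂, h₃]
    · by_cases h₁ : (k : ℕ) = j
      · simp [h₀, h₁]
      by_cases h₂ : (k : ℕ) = j + 1
      · simp [h₀, h₂]
      by_cases h₃ : (k : ℕ) = j + 1 + 1 <;> simp [h₀, h₁, h₂, h₃]
  case x_comm a b i j h =>
    have h₀ : (i : ℕ) ≠ j := fun e => h (Fin.ext e)
    by_cases h₁ : (k : ℕ) = i
    · simp [h₁, h₀]
    · simp [h₁]
  case s_x_comm i a hi j h h' =>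
    by_cases h₁ : (k : ℕ) = i <;> by_cases h₂ : (k : ℕ) = i + 1 <;>
      simp [h₁, h₂, h.symm, h'.symm]
  case s_x i a hi =>
    by_cases h₁ : (k : ℕ) = i <;> by_cases h₂ : (k : ℕ) = i + 1 <;> simp [h₁, h₂]
  case e_x_comm a i j h =>
    by_cases h₁ : (k : ℕ) = i <;> simp [h₁]
  case e_x a i => by_cases h₁ : (k : ℕ) = i <;> simp [h₁]
  case x_e a i => by_cases h₁ : (k : ℕ) = i <;> simp [h₁]
  case lam_rho => simp
  case rho_lam n =>
    by_cases h₁ : (k : ℕ) < n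
    · simp [h₁, h₁.ne]
    · have h₂ : (k : ℕ) = n := by
        change (k : ℕ) < n + 1 at hk
        omega
      simp [h₂]
  case s_lam i hi =>
    by_cases h₁ : (k : ℕ) = i <;> by_cases h₂ : (k : ℕ) = i + 1 <;> simp [h₁, h₂]
  case e_lam i => by_cases h₁ : (k : ℕ) = i <;> simp [h₁]
  case rho_s i hi =>
    by_cases h₁ : (k : ℕ) = i
    · simp [h₁, hi, Nat.lt_of_succ_lt hi]
    by_cases h₂ : (k : ℕ) = i + 1
    · simp [h₂, hi, Nat.lt_of_succ_lt hi]
    by_cases h₃ : (k : ℕ) < n <;> simp [h₁, h₂, h₃]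
  case rho_e i =>
    by_cases h₁ : (k : ℕ) < n <;> by_cases h₂ : (k : ℕ) = i <;> simp [h₁, h₂]
  case rho_x i a =>
    by_cases h₁ : (k : ℕ) < n <;> simp [h₁]

theorem wreathFunctor_sound (φ : FreeMonoid X →* M) (hR : ∀ u v, R u v → φ u = φ v)
    {m n : ℕ} {p q : vert X m ⟶ vert X n} (h : Rel R p q) :
    (wreathFunctor φ).map p = (wreathFunctor φ).map q :=
  WreathHom.ext_eval (pathEval_eq_of_rel φ hR h)

end

section
variable {X : Type u} {R : FreeMonoid X → FreeMonoid X → Prop} {M : Type v} [Monoid M]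

/-! ### Completeness -/

theorem qw_append {n : ℕ} (i : Fin n) (u v : List X) :
    qw R i (u ++ v) = qw R i u ≫ qw R i v := by
  induction u with
  | nil => rw [List.nil_append, qw_nil, Category.id_comp]
  | cons b u ih => rw [List.cons_append, qw_cons, qw_cons, ih, Category.assoc]

/-- Having equal classes at point `i` is a congruence on words, and it contains `R`. -/
theorem qw_eq_of_conGen {n : ℕ} (i : Fin n) {p q : FreeMonoid X} (h : conGen R p q) :
    qw R i p.toList = qw R i q.toList := by
  change ConGen.Rel R p q at h
  induction h with
  | of p q h => exact qw_eq i p q h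
  | refl => rfl
  | symm _ ih => exact ih.symm
  | trans _ _ ih ih' => exact ih.trans ih'
  | mul _ _ ih ih' =>
    rw [FreeMonoid.toList_mul, FreeMonoid.toList_mul, qw_append, qw_append, ih, ih']

/-- The functor from the presented category to the wreath product. -/
def presFunctor (φ : FreeMonoid X →* M) (hR : ∀ u v, R u v → φ u = φ v) :
    PresCat R ⥤ WreathCat M :=
  CategoryTheory.Quotient.lift _ (wreathFunctor φ) fun _ _ _ _ h =>
    map_eq_of_congruenceGen _ (fun _ _ _ _ h => wreathFunctor_sound φ hR h) h

section
variable {φ : FreeMonoid X →* M} {hR : ∀ u v, R u v → φ u = φ v}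

/-- Evaluation of a morphism between images of objects of the presented category. -/
def homEval {m n : ℕ} (f : (presFunctor φ hR).obj (pt R m) ⟶ (presFunctor φ hR).obj (pt R n))
    (i : Fin m) : Option (M × Fin n) :=
  WreathHom.eval f i

theorem hom_ext {m n : ℕ}
    {f g : (presFunctor φ hR).obj (pt R m) ⟶ (presFunctor φ hR).obj (pt R n)}
    (h : ∀ i, homEval f i = homEval g i) : f = g :=
  WreathHom.ext_eval h

theorem homEval_comp {m n k : ℕ}
    (f : (presFunctor φ hR).obj (pt R m) ⟶ (presFunctor φ hR).obj (pt R n))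
    (g : (presFunctor φ hR).obj (pt R n) ⟶ (presFunctor φ hR).obj (pt R k)) (i : Fin m) :
    homEval (f ≫ g) i =
      (homEval f i).bind fun p => (homEval g p.2).map fun q => (p.1 * q.1, q.2) :=
  WreathHom.eval_comp _ _ _

theorem homEval_id {n : ℕ} (i : Fin n) :
    homEval (𝟙 ((presFunctor φ hR).obj (pt R n))) i = some (1, i) :=
  WreathHom.eval_id _

/-! ### Values of the images at single points -/

theorem homEval_qw {n : ℕ} (u : FreeMonoid X) (i j : Fin n) :
    homEval ((presFunctor φ hR).map (qw R i u.toList)) j = some (if j = i then φ u else 1, j) :=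
  pathEval_wordPath φ u i j

theorem homEval_qe {n : ℕ} (i j : Fin n) :
    homEval ((presFunctor φ hR).map (qe R i)) j = if j = i then none else some (1, j) :=
  (pathEval_path φ _ _).trans (eval_genImage_e φ i j)

theorem homEval_ql {n : ℕ} (i : Fin n) :
    homEval ((presFunctor φ hR).map (ql R n)) i = some (1, i.castSucc) :=
  (pathEval_path φ _ _).trans (eval_genImage_lam φ i)

theorem homEval_qr_last (n : ℕ) :
    homEval ((presFunctor φ hR).map (qr R n)) (Fin.last n) = none :=
  (pathEval_path φ _ _).trans ((eval_genImage_rho φ _).trans (by simp))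

theorem homEval_qr_castSucc {n : ℕ} (i : Fin n) :
    homEval ((presFunctor φ hR).map (qr R n)) i.castSucc = some (1, i) :=
  (pathEval_path φ _ _).trans ((eval_genImage_rho φ _).trans (by simp))

theorem homEval_qt_last (n : ℕ) :
    homEval ((presFunctor φ hR).map (qt R n)) (Fin.last (n + 1)) =
      some (1, (Fin.last n).castSucc) :=
  (pathEval_path φ _ _).trans ((eval_genImage_s φ _ _ _).trans (by simp [Fin.ext_iff]))

theorem homEval_qt_castSucc_last (n : ℕ) :
    homEval ((presFunctor φ hR).map (qt R n)) (Fin.last n).castSucc =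
      some (1, Fin.last (n + 1)) :=
  (pathEval_path φ _ _).trans ((eval_genImage_s φ _ _ _).trans (by simp [Fin.ext_iff]))

theorem homEval_ql_comp {m n : ℕ}
    (f : (presFunctor φ hR).obj (pt R (m + 1)) ⟶ (presFunctor φ hR).obj (pt R n)) (i : Fin m) :
    homEval ((presFunctor φ hR).map (ql R m) ≫ f) i = homEval f i.castSucc := by
  simp [homEval_comp, homEval_ql]

theorem hom_ext_last {m n : ℕ}
    {f g : (presFunctor φ hR).obj (pt R (m + 1)) ⟶ (presFunctor φ hR).obj (pt R n)}
    (h : (presFunctor φ hR).map (ql R m) ≫ f = (presFunctor φ hR).map (ql R m) ≫ g)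
    (h' : homEval f (Fin.last m) = homEval g (Fin.last m)) : f = g := by
  refine hom_ext fun i => ?_
  induction i using Fin.lastCases with
  | last => exact h'
  | cast i => rw [← homEval_ql_comp, h, homEval_ql_comp]

/-- This is naturality of `ql`, evaluated at a point; no induction on `f` is needed. -/
theorem homEval_shift_castSucc {m n : ℕ} (f : pt R m ⟶ pt R n) (i : Fin m) :
    homEval ((presFunctor φ hR).map (shift f)) i.castSucc =
      (homEval ((presFunctor φ hR).map f) i).map fun p => (p.1, p.2.castSucc) := by
  rw [← homEval_ql_comp, ← CategoryTheory.Functor.map_comp, ← comp_ql,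
    CategoryTheory.Functor.map_comp, homEval_comp]
  cases homEval ((presFunctor φ hR).map f) i <;> simp [homEval_ql]

theorem homEval_shift_last {m n : ℕ} (f : pt R m ⟶ pt R n) :
    homEval ((presFunctor φ hR).map (shift f)) (Fin.last m) = some (1, Fin.last n) := by
  induction f using pres_induction with
  | id => rw [shift_id, CategoryTheory.Functor.map_id, homEval_id]
  | @comp n k f g ih =>
    suffices h : homEval ((presFunctor φ hR).map (shift (cls R (path g)))) (Fin.last n) =
        some (1, Fin.last k) by
      rw [shift_comp, CategoryTheory.Functor.map_comp, homEval_comp, ih]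
      simp [h]
    rw [shift_path]
    cases g with
    | s i hi =>
      refine (pathEval_path φ _ _).trans ((eval_genImage_s φ _ _ _).trans ?_)
      rw [if_neg (by simp; omega), if_neg (by simp; omega)]
    | e i =>
      refine (pathEval_path φ _ _).trans ((eval_genImage_e φ _ _).trans ?_)
      rw [if_neg (Fin.castSucc_lt_last i).ne']
    | x a i =>
      refine (pathEval_path φ _ _).trans ((eval_genImage_x φ _ _ _).trans ?_)
      rw [if_neg (Fin.castSucc_lt_last i).ne']
    | lam =>
      change homEval ((presFunctor φ hR).map (ql R (n + 1) ≫ qt R n)) _ = _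
      rw [CategoryTheory.Functor.map_comp, homEval_ql_comp, homEval_qt_castSucc_last]
    | rho =>
      change homEval ((presFunctor φ hR).map (qt R k ≫ qr R (k + 1))) _ = _
      rw [CategoryTheory.Functor.map_comp, homEval_comp, homEval_qt_last]
      simp [homEval_qr_castSucc]

theorem homEval_qc_last {n : ℕ} (j : Fin (n + 1)) :
    homEval ((presFunctor φ hR).map (qc R n j)) (Fin.last n) = some (1, j) := by
  induction n with
  | zero =>
    obtain rfl : j = Fin.last 0 := Fin.ext (by omega)
    rw [qc_last, CategoryTheory.Functor.map_id, homEval_id]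
  | succ n ih =>
    induction j using Fin.lastCases with
    | last => rw [qc_last, CategoryTheory.Functor.map_id, homEval_id]
    | cast j =>
      rw [qc_castSucc, CategoryTheory.Functor.map_comp, homEval_comp, homEval_qt_last]
      simp [homEval_shift_castSucc, ih]

theorem homEval_qr_comp_last {m n : ℕ} (f : pt R m ⟶ pt R n) :
    homEval ((presFunctor φ hR).map (qr R m ≫ f)) (Fin.last m) = none := by
  rw [CategoryTheory.Functor.map_comp, homEval_comp, homEval_qr_last, Option.bind_none]

theorem homEval_some_last {m n : ℕ} (f : pt R m ⟶ pt R n) (u : FreeMonoid X)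
    (j : Fin (n + 1)) :
    homEval ((presFunctor φ hR).map (qw R (Fin.last m) u.toList ≫ shift f ≫ qc R n j))
      (Fin.last m) = some (φ u, j) := by
  simp [CategoryTheory.Functor.map_comp, homEval_comp, homEval_qw, homEval_shift_last,
    homEval_qc_last]

/-- Since the last point is not in the image of `ql`, its label disappears and only `f` with the
cycle remains. -/
theorem ql_comp_some {m n : ℕ} (f : pt R m ⟶ pt R n) (u : List X) (j : Fin (n + 1)) :
    ql R m ≫ qw R (Fin.last m) u ≫ shift f ≫ qc R n j = f ≫ ql R n ≫ qc R n j := by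
  rw [reassoc_of% ql_qw, ← reassoc_of% comp_ql]

end

theorem presFunctor_map_injective {φ : FreeMonoid X →* M} (hM : IsMonoidPresentation R φ)
    {hR : ∀ u v, R u v → φ u = φ v} {m n : ℕ} {f g : pt R m ⟶ pt R n}
    (h : (presFunctor φ hR).map f = (presFunctor φ hR).map g) : f = g := by
  induction m generalizing n with
  | zero => rw [eq_qz f, eq_qz g]
  | succ m ih =>
    have hlast := congrArg (homEval · (Fin.last m)) h
    have hf := isNormal f
    have hg := isNormal g
    cases hf with
    | none f =>
      cases hg with
      | none g =>
        congr 1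
        apply ih
        -- Since `ql` is a right-invertible morphism with inverse `qr`, composing with it on the
        -- left removes `qr` and leaves `f` and `g`.
        have h' := congrArg ((presFunctor φ hR).map (ql R m) ≫ ·) h
        simpa only [← CategoryTheory.Functor.map_comp, reassoc_of% ql_qr] using h'
      | some g v k =>
        exact absurd ((homEval_qr_comp_last f).symm.trans
          (hlast.trans (homEval_some_last g (FreeMonoid.ofList v) k))) (by simp)
    | @some n f u j =>
      cases hg with
      | none g =>
        exact absurd ((homEval_qr_comp_last g).symm.trans
          (hlast.symm.trans (homEval_some_last f (FreeMonoid.ofList u) j))) (by simp)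
      | some g v k =>
        have hlast' := (homEval_some_last f (FreeMonoid.ofList u) j).symm.trans
          (hlast.trans (homEval_some_last g (FreeMonoid.ofList v) k))
        simp only [Option.some.injEq, Prod.mk.injEq] at hlast'
        obtain ⟨huv, rfl⟩ := hlast'
        -- Equal values in `M` become congruent words; here the description of the kernel of `φ`
        -- enters.
        have hqw : qw R (Fin.last m) u = qw R (Fin.last m) v :=
          qw_eq_of_conGen (R := R) (Fin.last m) (p := FreeMonoid.ofList u)
            (q := FreeMonoid.ofList v) (by rw [← hM.ker_eq]; exact huv)
        obtain ⟨d, hd, -⟩ := exists_qc_comp_qc_eq_id (R := R) j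
        -- Undoing the cycle by `d` and cutting off the last strand at both ends recovers `f`,
        -- whatever the word.
        have key (f : pt R m ⟶ pt R n) (u : List X) :
            ql R m ≫ (qw R (Fin.last m) u ≫ shift f ≫ qc R n j) ≫ d ≫ qr R n = f := by
          rw [← Category.assoc, ql_comp_some, Category.assoc, Category.assoc, reassoc_of% hd,
            ql_qr, Category.comp_id]
        have h' := congrArg (fun t => (presFunctor φ hR).map (ql R m) ≫ t ≫
          (presFunctor φ hR).map (d ≫ qr R n)) h
        simp only [← CategoryTheory.Functor.map_comp, key] at h'
        rw [ih h', hqw]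

theorem presFunctor_map_surjective {φ : FreeMonoid X →* M} (hφ : Function.Surjective φ)
    {hR : ∀ u v, R u v → φ u = φ v} {m n : ℕ}
    (f : (presFunctor φ hR).obj (pt R m) ⟶ (presFunctor φ hR).obj (pt R n)) :
    ∃ p : pt R m ⟶ pt R n, (presFunctor φ hR).map p = f := by
  induction m generalizing n with
  | zero => exact ⟨qz R n, hom_ext fun i => i.elim0⟩
  | succ m ih =>
    cases hf : homEval f (Fin.last m) with
    | none =>
      obtain ⟨p, hp⟩ := ih ((presFunctor φ hR).map (ql R m) ≫ f)
      refine ⟨qr R m ≫ p, hom_ext_last ?_ ?_⟩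
      · rw [← CategoryTheory.Functor.map_comp, reassoc_of% ql_qr, hp]
      · rw [homEval_qr_comp_last, hf]
    | some q =>
      obtain ⟨a, j⟩ := q
      obtain ⟨u, rfl⟩ := hφ a
      obtain _ | n := n
      · exact j.elim0
      obtain ⟨d, -, hd⟩ := exists_qc_comp_qc_eq_id (R := R) j
      -- The induction applies to `f` with the last point removed from the source and its image `j`
      -- removed from the target.
      obtain ⟨p, hp⟩ := ih ((presFunctor φ hR).map (ql R m) ≫ f ≫
        (presFunctor φ hR).map (d ≫ qr R n))
      refine ⟨qw R (Fin.last m) u.toList ≫ shift p ≫ qc R n j, hom_ext_last ?_ ?_⟩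
      · have hdj : (d ≫ qr R n) ≫ ql R n ≫ qc R n j = qe R j := by
          rw [Category.assoc, reassoc_of% qr_ql, ← isLocal_qe.qc_self, reassoc_of% hd]
        rw [← CategoryTheory.Functor.map_comp, ql_comp_some, CategoryTheory.Functor.map_comp, hp,
          Category.assoc, Category.assoc, ← CategoryTheory.Functor.map_comp, hdj]
        refine hom_ext fun i => ?_
        rw [homEval_ql_comp, homEval_ql_comp, homEval_comp]
        cases hi : homEval f i.castSucc with
        | none => rfl
        | some q =>
          have hq : q.2 ≠ j := by
            rintro rfl
            exact (Fin.castSucc_lt_last i).ne (WreathHom.eval_injOn f hi hf)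
          simp [homEval_qe, hq]
      · rw [homEval_some_last, hf]

end

end WreathPresentation

theorem mainTheorem3 {M : Type*} [Monoid M] {X : Type*}
    (R : FreeMonoid X → FreeMonoid X → Prop) (φ : FreeMonoid X →* M)
    (hM : WreathPresentation.IsMonoidPresentation R φ) :
    (∀ n : ℕ, (WreathPresentation.wreathFunctor φ).obj (WreathPresentation.vert X n) = n) ∧
      WreathPresentation.IsCategoryPresentation (WreathPresentation.Rel R)
        (WreathPresentation.wreathFunctor φ) := by
  open WreathPresentation CategoryTheory in
  have hR : ∀ u v, R u v → φ u = φ v := fun u v h => by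
    have h' : conGen R u v := ConGen.Rel.of u v h
    rwa [← hM.ker_eq] at h'
  refine ⟨fun n => rfl, Function.bijective_id, fun a b f => ?_, fun a b p q => ⟨fun h => ?_, ?_⟩⟩
  · obtain ⟨p, hp⟩ := WreathPresentation.presFunctor_map_surjective (R := R) hM.surjective
      (hR := hR) (m := a) (n := b) f
    obtain ⟨p, rfl⟩ := (CategoryTheory.Quotient.functor _).map_surjective p
    exact ⟨p, hp⟩
  · exact (CategoryTheory.Quotient.functor_map_eq_iff _ _ _).mp
      (WreathPresentation.presFunctor_map_injective hM (hR := hR) (m := a) (n := b)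
        (f := WreathPresentation.cls R p) (g := WreathPresentation.cls R q) h)
  · exact WreathPresentation.map_eq_of_congruenceGen _
      fun _ _ _ _ h => WreathPresentation.wreathFunctor_sound φ hR h
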